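/- A perfect secret sharing scheme $\mathcal S$ for a finite simple graph $G=(V,E)$ consists of random variables $\xi$ (the secret) and $\xi_v$, $v\in V$ (the shares), each taking finitely many values, on a common probability space, with Shannon entropy $H(\xi)>0$, such that (i) if $vw\in E$, then $\xi_v$ and $\xi_w$ together determine $\xi$ (almost surely), and (ii) if $A\subseteq V$ is an independent set, then $\xi$ and $(\xi_v)_{v\in A}$ are statistically independent. The information ratio of $\mathcal S$ is $\max_{v\in V}H(\xi_v)/H(\xi)$, and the information ratio of $G$ is the infimum of the information ratios of all perfect secret sharing schemes for $G$. Let $M(n)$ be the largest information ratio of a graph on $n$ vertices. There is an explicit constant $c>0$, namely $c=4$ will do, such that for infinitely many $n$ $$0.5\cdot\log_2 n\;\le\; M(n)\;\le\; c\cdot\frac{n}{\log_2 n}.$$ More precisely, the upper bound holds for every $n\ge 2$, and the lower bound is witnessed by cubes: for every $d\ge 2$ the edge graph of the $d$-dimensional cube (vertices the $0$–$1$ sequences of length $d$, two adjacent when they differ in exactly one place), which has $n=2^d$ vertices, has information ratio at least $0.5\cdot\log_2 n$. -/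

import Mathlib

open MeasureTheory ProbabilityTheory

noncomputable section

/-- Shannon entropy (in bits) of a random variable with values in a finite set:
`H(X) = - ∑ x, P(X = x) log₂ P(X = x)`, with `0 log 0 = 0`. -/
def shannonEntropy {Ω : Type*} [MeasurableSpace Ω] (μ : Measure Ω)
    {S : Type*} [Fintype S] (X : Ω → S) : ℝ :=
  ∑ x : S, Real.negMulLog (μ.real (X ⁻¹' {x})) / Real.log 2

/-- A perfect secret sharing scheme for the graph `G`: a secret and one share for each vertex,
random variables with finite alphabets on a common probability space, such that the two shares at
the ends of an edge determine the secret (almost surely), while the shares of any independent set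
of vertices are jointly statistically independent of the secret. The secret is required to be
nontrivial (positive entropy), as the information ratio divides by its entropy. -/
structure PerfectSecretSharingScheme {V : Type*} (G : SimpleGraph V) where
  Ω : Type
  [measurableSpaceΩ : MeasurableSpace Ω]
  μ : Measure Ω
  [isProbabilityMeasure : IsProbabilityMeasure μ]
  Secret : Type
  [fintypeSecret : Fintype Secret]
  [measurableSpaceSecret : MeasurableSpace Secret]
  [discreteSecret : DiscreteMeasurableSpace Secret]
  Share : V → Type
  [fintypeShare : ∀ v, Fintype (Share v)]
  [measurableSpaceShare : ∀ v, MeasurableSpace (Share v)]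
  [discreteShare : ∀ v, DiscreteMeasurableSpace (Share v)]
  secret : Ω → Secret
  measurable_secret : Measurable secret
  share : ∀ v, Ω → Share v
  measurable_share : ∀ v, Measurable (share v)
  edge_determines : ∀ v w, G.Adj v w →
    ∃ decode : Share v → Share w → Secret, ∀ᵐ ω ∂μ, secret ω = decode (share v ω) (share w ω)
  indep_of_isIndepSet : ∀ A : Set V, G.IsIndepSet A →
    IndepFun secret (fun ω (v : A) => share v ω) μ
  entropy_secret_pos : 0 < shannonEntropy μ secret

attribute [instance] PerfectSecretSharingScheme.measurableSpaceΩ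
  PerfectSecretSharingScheme.isProbabilityMeasure
  PerfectSecretSharingScheme.fintypeSecret
  PerfectSecretSharingScheme.measurableSpaceSecret
  PerfectSecretSharingScheme.discreteSecret
  PerfectSecretSharingScheme.fintypeShare
  PerfectSecretSharingScheme.measurableSpaceShare
  PerfectSecretSharingScheme.discreteShare

/-- The (worst case) information ratio of a scheme: the maximum over the vertices `v` of
`H(ξ_v) / H(ξ)`. -/
def PerfectSecretSharingScheme.ratio {V : Type*} {G : SimpleGraph V}
    (𝒮 : PerfectSecretSharingScheme G) : ℝ :=
  ⨆ v : V, shannonEntropy 𝒮.μ (𝒮.share v) / shannonEntropy 𝒮.μ 𝒮.secret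

/-- The (worst case) information ratio of a graph: the infimum of the information ratios of all
perfect secret sharing schemes for it. -/
def informationRatio {V : Type*} (G : SimpleGraph V) : ℝ :=
  ⨅ 𝒮 : PerfectSecretSharingScheme G, 𝒮.ratio

/-- The largest information ratio of a graph on `n` vertices (a maximum over finitely many
graphs). -/
def largestInformationRatio (n : ℕ) : ℝ :=
  ⨆ G : SimpleGraph (Fin n), informationRatio G

/-- The edge graph of the `d`-dimensional cube: 0-1 sequences of length `d`, two of them adjacent
when they differ in exactly one place. -/
def cubeGraph (d : ℕ) : SimpleGraph (Fin d → Bool) where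
  Adj x y := hammingDist x y = 1
  symm := ⟨fun x y h => by rwa [hammingDist_comm]⟩
  loopless := ⟨fun x h => by simp at h⟩

end

/-!
For a scheme with secret `ξ` and shares `ξ_v`, consider `f X = H(ξ_X) / H(ξ)` on sets `X` of
vertices. Both `H(ξ_X)` and `H(ξ, ξ_X)` are monotone and submodular in `X`. Since `H(ξ, ξ_X)` is
`H(ξ_X)` if `X` contains an edge and `H(ξ_X) + H(ξ)` if `X` is independent, `f` gains one in
monotonicity from an independent set to a set with an edge, and in submodularity for two sets with
an edge whose intersection is independent.

Lower bound: for a bipartition of the cube, compare the sum of `f` over the sets obtained by adding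
a vertex to one color class with the sum over those obtained by removing a vertex from it. Their
difference is at most `∑ x, f {x} - k d`, where `k 1 = 0` and `k (d + 1) = 2 * k d + 2 ^ d`: the
`(d + 1)`-dimensional cube consists of two copies of the `d`-dimensional one joined by `2 ^ d`
rungs, and each rung allows one use of the strict submodularity. On the other hand, strict
monotonicity makes the difference at least `2 ^ (d - 1)`. Hence
`∑ x, f {x} ≥ k d + 2 ^ (d - 1) = d / 2 * 2 ^ d`, and some vertex has `f {x} ≥ d / 2`.

Upper bound: if the edges of the graph are covered by bicliques, mask a secret bit with one fresh
random bit for each biclique; a vertex then holds one bit for each biclique that contains it. Split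
the vertices into blocks of about `(log₂ n) / 2` vertices, and for each set `S` inside a block join
`S` to the vertices whose set of neighbors in the block is `S`. A vertex lies on the second side of
one of these bicliques for each block, and on the first side of at most about `√n` of them, the sets
`S` that contain it.
-/

section LogSumInequality

variable {ι κ : Type*}

theorem negMulLog_add_mul_log_le_sub {p q : ℝ} (hp : 0 ≤ p) (hq : 0 ≤ q) (hpq : q = 0 → p = 0) :
    Real.negMulLog p + p * Real.log q ≤ q - p := by
  rcases hq.eq_or_lt' with rfl | hq
  · simp [hpq rfl]
  calc Real.negMulLog p + p * Real.log q
      = Real.negMulLog (q * (p / q)) + p * Real.log q := by rw [mul_div_cancel₀ p hq.ne']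
    _ = q * Real.negMulLog (p / q) := by
        rw [Real.negMulLog_mul, Real.negMulLog]
        field_simp
        ring
    _ ≤ q * (1 - p / q) :=
        mul_le_mul_of_nonneg_left (Real.negMulLog_le_one_sub_self (div_nonneg hp hq.le)) hq.le
    _ = q - p := by field_simp

theorem sum_negMulLog_add_sum_mul_log_le {s : Finset ι} {p a : ι → ℝ} (hp : ∀ i ∈ s, 0 ≤ p i)
    (ha : ∀ i ∈ s, 0 ≤ a i) (hpa : ∀ i ∈ s, a i = 0 → p i = 0) :
    ∑ i ∈ s, Real.negMulLog (p i) + ∑ i ∈ s, p i * Real.log (a i) ≤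
      Real.negMulLog (∑ i ∈ s, p i) + (∑ i ∈ s, p i) * Real.log (∑ i ∈ s, a i) := by
  set P := ∑ i ∈ s, p i with hP
  set A := ∑ i ∈ s, a i with hA
  have hP0 : 0 ≤ P := Finset.sum_nonneg hp
  have hA0 : 0 ≤ A := Finset.sum_nonneg ha
  have hsupp : ∀ i ∈ s, p i ≠ 0 → a i ≠ 0 ∧ P ≠ 0 ∧ A ≠ 0 := fun i hi h =>
    have hai : a i ≠ 0 := mt (hpa i hi) h
    ⟨hai, (((hp i hi).lt_of_ne' h).trans_le (Finset.single_le_sum hp hi)).ne',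
      (((ha i hi).lt_of_ne' hai).trans_le (Finset.single_le_sum ha hi)).ne'⟩
  have hterm : ∀ i ∈ s, Real.negMulLog (p i) + p i * Real.log (a i) ≤
      a i * (P / A) - p i - p i * Real.log P + p i * Real.log A := fun i hi => by
    by_cases h : p i = 0
    · simpa [h] using mul_nonneg (ha i hi) (div_nonneg hP0 hA0)
    obtain ⟨hai, hP', hA'⟩ := hsupp i hi h
    have := negMulLog_add_mul_log_le_sub (q := a i * (P / A)) (hp i hi)
      (mul_nonneg (ha i hi) (div_nonneg hP0 hA0))
      (fun h0 => absurd h0 (mul_ne_zero hai (div_ne_zero hP' hA')))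
    rw [Real.log_mul hai (div_ne_zero hP' hA'), Real.log_div hP' hA'] at this
    linarith
  have hmass : A * (P / A) ≤ P := by
    rcases eq_or_ne A 0 with h | h
    · simpa [h] using hP0
    · rw [mul_div_cancel₀ P h]
  have h := Finset.sum_le_sum hterm
  simp only [Finset.sum_add_distrib, Finset.sum_sub_distrib, ← Finset.sum_mul, ← hP, ← hA] at h
  rw [Real.negMulLog]
  linarith

theorem negMulLog_sum_le {s : Finset ι} {p : ι → ℝ} (hp : ∀ i ∈ s, 0 ≤ p i) :
    Real.negMulLog (∑ i ∈ s, p i) ≤ ∑ i ∈ s, Real.negMulLog (p i) := by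
  rw [Real.negMulLog, neg_mul, Finset.sum_mul, ← Finset.sum_neg_distrib]
  refine Finset.sum_le_sum fun i hi => ?_
  rcases (hp i hi).eq_or_lt' with h0 | h0
  · simp [h0]
  rw [Real.negMulLog, neg_mul, neg_le_neg_iff]
  gcongr
  exact Finset.single_le_sum hp hi

theorem sum_sum_negMulLog_add_negMulLog_sum_sum_le {s : Finset ι} {t : Finset κ} {p : ι → κ → ℝ}
    (hp : ∀ i ∈ s, ∀ j ∈ t, 0 ≤ p i j) :
    ∑ i ∈ s, ∑ j ∈ t, Real.negMulLog (p i j) + Real.negMulLog (∑ i ∈ s, ∑ j ∈ t, p i j) ≤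
      ∑ i ∈ s, Real.negMulLog (∑ j ∈ t, p i j) + ∑ j ∈ t, Real.negMulLog (∑ i ∈ s, p i j) := by
  have hcol : ∀ j ∈ t, ∑ i ∈ s, Real.negMulLog (p i j) +
        ∑ i ∈ s, p i j * Real.log (∑ j ∈ t, p i j) ≤
      Real.negMulLog (∑ i ∈ s, p i j) +
        (∑ i ∈ s, p i j) * Real.log (∑ i ∈ s, ∑ j ∈ t, p i j) := fun j hj =>
    sum_negMulLog_add_sum_mul_log_le (fun i hi => hp i hi j hj)
      (fun i hi => Finset.sum_nonneg (hp i hi))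
      (fun i hi h => (Finset.sum_eq_zero_iff_of_nonneg (hp i hi)).1 h j hj)
  have h := Finset.sum_le_sum hcol
  simp only [Finset.sum_add_distrib] at h
  rw [← Finset.sum_mul, Finset.sum_comm, Finset.sum_comm (f := fun j i => p i j),
    Finset.sum_comm (f := fun j i => p i j * _)] at h
  simp only [← Finset.sum_mul] at h
  simp only [Real.negMulLog, neg_mul, Finset.sum_neg_distrib] at h ⊢
  linarith

end LogSumInequality

section Entropy

variable {Ω : Type*} [MeasurableSpace Ω] {μ : Measure Ω}
  {S T U : Type*} [Fintype S] [Fintype T] [Fintype U]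

theorem shannonEntropy_eq_sum_div (X : Ω → S) :
    shannonEntropy μ X = (∑ x, Real.negMulLog (μ.real (X ⁻¹' {x}))) / Real.log 2 :=
  (Finset.sum_div _ _ _).symm

theorem shannonEntropy_prodMk (X : Ω → S) (Y : Ω → T) :
    shannonEntropy μ (fun ω => (X ω, Y ω)) =
      (∑ x, ∑ y, Real.negMulLog (μ.real (X ⁻¹' {x} ∩ Y ⁻¹' {y}))) / Real.log 2 := by
  simp only [shannonEntropy_eq_sum_div, Fintype.sum_prod_type, ← Set.singleton_prod_singleton,
    Set.mk_preimage_prod]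

theorem shannonEntropy_nonneg [IsProbabilityMeasure μ] (X : Ω → S) : 0 ≤ shannonEntropy μ X :=
  Finset.sum_nonneg fun _ _ => div_nonneg
    (Real.negMulLog_nonneg measureReal_nonneg measureReal_le_one) (Real.log_nonneg one_le_two)

theorem shannonEntropy_prodMk_of_ae_eq {X : Ω → S} {Y : Ω → T} (g : T → S)
    (h : ∀ᵐ ω ∂μ, X ω = g (Y ω)) :
    shannonEntropy μ (fun ω => (X ω, Y ω)) = shannonEntropy μ Y := by
  rw [shannonEntropy_prodMk, shannonEntropy_eq_sum_div, Finset.sum_comm]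
  congr 1
  refine Finset.sum_congr rfl fun y _ => ?_
  rw [Fintype.sum_eq_single (g y)]
  · congr 1
    refine measureReal_congr ?_
    filter_upwards [h] with ω hω
    exact propext (and_iff_right_of_imp fun hy => hω.trans (congrArg g hy))
  · intro x hx
    have : μ (X ⁻¹' {x} ∩ Y ⁻¹' {y}) = 0 := by
      rw [measure_eq_zero_iff_ae_notMem]
      filter_upwards [h] with ω hω
      rintro ⟨rfl, rfl⟩
      exact hx hω
    rw [measureReal_def, this, ENNReal.toReal_zero, Real.negMulLog_zero]

variable [MeasurableSpace T] [MeasurableSingletonClass T]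

theorem sum_measureReal_inter_preimage_singleton [IsFiniteMeasure μ] {Y : Ω → T}
    (hY : Measurable Y) (A : Set Ω) : ∑ y, μ.real (A ∩ Y ⁻¹' {y}) = μ.real A := by
  have hfib : ∀ y, MeasurableSet (Y ⁻¹' {y}) := fun y => hY (measurableSet_singleton y)
  simpa [measureReal_restrict_apply (hfib _), Set.inter_comm] using
    sum_measureReal_preimage_singleton (μ := μ.restrict A) (f := Y) Finset.univ fun y _ => hfib y

theorem shannonEntropy_le_prodMk [IsFiniteMeasure μ] (X : Ω → S) {Y : Ω → T}
    (hY : Measurable Y) : shannonEntropy μ X ≤ shannonEntropy μ (fun ω => (X ω, Y ω)) := by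
  rw [shannonEntropy_prodMk, shannonEntropy_eq_sum_div]
  refine div_le_div_of_nonneg_right (Finset.sum_le_sum fun x _ => ?_) (Real.log_nonneg one_le_two)
  rw [← sum_measureReal_inter_preimage_singleton hY]
  exact negMulLog_sum_le fun _ _ => measureReal_nonneg

theorem shannonEntropy_le_of_ae_eq [IsFiniteMeasure μ] {X : Ω → S} {Y : Ω → T}
    (hY : Measurable Y) (g : T → S) (h : ∀ᵐ ω ∂μ, X ω = g (Y ω)) :
    shannonEntropy μ X ≤ shannonEntropy μ Y :=
  (shannonEntropy_le_prodMk X hY).trans_eq (shannonEntropy_prodMk_of_ae_eq g h)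

variable [MeasurableSpace S] [MeasurableSingletonClass S]

theorem sum_measureReal_preimage_singleton_eq_one [IsProbabilityMeasure μ] {X : Ω → S}
    (hX : Measurable X) : ∑ x, μ.real (X ⁻¹' {x}) = 1 := by
  simpa using sum_measureReal_inter_preimage_singleton hX (Set.univ : Set Ω) (μ := μ)

theorem shannonEntropy_le_logb_card [IsProbabilityMeasure μ] {X : Ω → S} (hX : Measurable X) :
    shannonEntropy μ X ≤ Real.logb 2 (Fintype.card S) := by
  rw [shannonEntropy_eq_sum_div, Real.logb]
  refine div_le_div_of_nonneg_right ?_ (Real.log_nonneg one_le_two)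
  simpa [sum_measureReal_preimage_singleton_eq_one hX] using
    sum_negMulLog_add_sum_mul_log_le (s := Finset.univ) (p := fun x => μ.real (X ⁻¹' {x}))
      (a := fun _ => 1) (fun _ _ => measureReal_nonneg) (fun _ _ => zero_le_one)
      (fun _ _ h => absurd h one_ne_zero)

theorem shannonEntropy_prodMk_of_indepFun [IsProbabilityMeasure μ] {X : Ω → S} {Y : Ω → T}
    (hX : Measurable X) (hY : Measurable Y) (h : IndepFun X Y μ) :
    shannonEntropy μ (fun ω => (X ω, Y ω)) = shannonEntropy μ X + shannonEntropy μ Y := by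
  have hjoint : ∀ x y, μ.real (X ⁻¹' {x} ∩ Y ⁻¹' {y}) = μ.real (X ⁻¹' {x}) * μ.real (Y ⁻¹' {y}) :=
    fun x y => by
      simp only [measureReal_def, h.measure_inter_preimage_eq_mul {x} {y}
        (measurableSet_singleton x) (measurableSet_singleton y), ENNReal.toReal_mul]
  simp only [shannonEntropy_prodMk X Y, shannonEntropy_eq_sum_div X, shannonEntropy_eq_sum_div Y,
    hjoint, Real.negMulLog_mul, Finset.sum_add_distrib, ← Finset.sum_mul, ← Finset.mul_sum,
    sum_measureReal_preimage_singleton_eq_one hX, sum_measureReal_preimage_singleton_eq_one hY,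
    one_mul, add_div]

theorem shannonEntropy_submodular [IsFiniteMeasure μ] {X : Ω → S} {Y : Ω → T} (Z : Ω → U)
    (hX : Measurable X) (hY : Measurable Y) :
    shannonEntropy μ (fun ω => (Z ω, X ω, Y ω)) + shannonEntropy μ Z ≤
      shannonEntropy μ (fun ω => (Z ω, X ω)) + shannonEntropy μ (fun ω => (Z ω, Y ω)) := by
  have hZX : ∀ z x, ∑ y, μ.real (Z ⁻¹' {z} ∩ (X ⁻¹' {x} ∩ Y ⁻¹' {y})) =
      μ.real (Z ⁻¹' {z} ∩ X ⁻¹' {x}) := fun z x => by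
    simp only [← Set.inter_assoc, sum_measureReal_inter_preimage_singleton hY]
  have hZY : ∀ z y, ∑ x, μ.real (Z ⁻¹' {z} ∩ (X ⁻¹' {x} ∩ Y ⁻¹' {y})) =
      μ.real (Z ⁻¹' {z} ∩ Y ⁻¹' {y}) := fun z y => by
    simp only [Set.inter_comm (X ⁻¹' _), ← Set.inter_assoc,
      sum_measureReal_inter_preimage_singleton hX]
  have hfibre := fun z => sum_sum_negMulLog_add_negMulLog_sum_sum_le (s := Finset.univ)
    (t := Finset.univ) (p := fun x y => μ.real (Z ⁻¹' {z} ∩ (X ⁻¹' {x} ∩ Y ⁻¹' {y})))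
    fun _ _ _ _ => measureReal_nonneg
  simp only [hZX, hZY, sum_measureReal_inter_preimage_singleton hX] at hfibre
  simp only [shannonEntropy_eq_sum_div, Fintype.sum_prod_type,
    ← Set.singleton_prod_singleton, Set.mk_preimage_prod, ← add_div, ← Finset.sum_add_distrib]
  exact div_le_div_of_nonneg_right (Finset.sum_le_sum fun z _ => hfibre z)
    (Real.log_nonneg one_le_two)

theorem shannonEntropy_add_le_of_determined [IsFiniteMeasure μ] {R : Type*} [Fintype R]
    {W : Ω → R} {X : Ω → S} {Y : Ω → T} {Z : Ω → U} (hX : Measurable X) (hY : Measurable Y)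
    (w : S → T → R) (hW : ∀ ω, W ω = w (X ω) (Y ω)) (z : S → U) (hZX : ∀ ω, Z ω = z (X ω))
    (z' : T → U) (hZY : ∀ ω, Z ω = z' (Y ω)) :
    shannonEntropy μ W + shannonEntropy μ Z ≤ shannonEntropy μ X + shannonEntropy μ Y :=
  calc shannonEntropy μ W + shannonEntropy μ Z
      ≤ shannonEntropy μ (fun ω => (X ω, Y ω)) + shannonEntropy μ Z := by
        gcongr
        exact shannonEntropy_le_of_ae_eq (hX.prodMk hY) (fun q => w q.1 q.2) (ae_of_all _ hW)
    _ = shannonEntropy μ (fun ω => (Z ω, X ω, Y ω)) + shannonEntropy μ Z := by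
        rw [shannonEntropy_prodMk_of_ae_eq (fun q => z q.1) (ae_of_all _ hZX)]
    _ ≤ shannonEntropy μ (fun ω => (Z ω, X ω)) + shannonEntropy μ (fun ω => (Z ω, Y ω)) :=
        shannonEntropy_submodular Z hX hY
    _ = shannonEntropy μ X + shannonEntropy μ Y := by
        rw [shannonEntropy_prodMk_of_ae_eq z (ae_of_all _ hZX),
          shannonEntropy_prodMk_of_ae_eq z' (ae_of_all _ hZY)]

end Entropy

/-- The properties of the normalized entropy `X ↦ H(ξ_X) / H(ξ)` of the shares of a perfect secret
sharing scheme: a monotone submodular function, with a gain of one when passing from an independent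
set to a set containing an edge, and in the submodular inequality for two sets that contain edges
and meet in an independent set. -/
structure IsSecretPolymatroid {V : Type*} [DecidableEq V] (G : SimpleGraph V)
    (f : Finset V → ℝ) : Prop where
  empty_nonneg : 0 ≤ f ∅
  mono : Monotone f
  submodular : ∀ X Y, f (X ∪ Y) + f (X ∩ Y) ≤ f X + f Y
  strict_mono : ∀ X Y : Finset V, X ⊆ Y → G.IsIndepSet (X : Set V) → ¬ G.IsIndepSet (Y : Set V) →
    f X + 1 ≤ f Y
  strict_submodular : ∀ X Y : Finset V, ¬ G.IsIndepSet (X : Set V) → ¬ G.IsIndepSet (Y : Set V) →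
    G.IsIndepSet ((X ∩ Y : Finset V) : Set V) → f (X ∪ Y) + f (X ∩ Y) + 1 ≤ f X + f Y

theorem isIndepSet_map_iff {V W : Type*} {G : SimpleGraph V} {H : SimpleGraph W} (φ : H ↪g G)
    (X : Finset W) :
    G.IsIndepSet (X.map φ.toEmbedding : Set V) ↔ H.IsIndepSet (X : Set W) := by
  rw [Finset.coe_map, SimpleGraph.isIndepSet_iff, SimpleGraph.isIndepSet_iff,
    φ.toEmbedding.injective.injOn.pairwise_image]
  simp only [Set.Pairwise, Function.onFun_apply, RelEmbedding.coe_toEmbedding, φ.map_adj_iff]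

namespace IsSecretPolymatroid

variable {V W : Type*} [DecidableEq V] [DecidableEq W] {G : SimpleGraph V} {H : SimpleGraph W}
  {f : Finset V → ℝ}

theorem comap (hf : IsSecretPolymatroid G f) (φ : H ↪g G) :
    IsSecretPolymatroid H (fun X => f (X.map φ.toEmbedding)) where
  empty_nonneg := hf.empty_nonneg
  mono _ _ h := hf.mono (Finset.map_subset_map.2 h)
  submodular X Y := by simpa only [Finset.map_union, Finset.map_inter] using hf.submodular _ _
  strict_mono X Y h hX hY := hf.strict_mono _ _ (Finset.map_subset_map.2 h)
    ((isIndepSet_map_iff φ X).2 hX) (mt (isIndepSet_map_iff φ Y).1 hY)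
  strict_submodular X Y hX hY hXY := by
    simpa only [Finset.map_union, Finset.map_inter] using
      hf.strict_submodular _ _ (mt (isIndepSet_map_iff φ X).1 hX)
        (mt (isIndepSet_map_iff φ Y).1 hY)
        (by rw [← Finset.map_inter]; exact (isIndepSet_map_iff φ _).2 hXY)

theorem apply_insert_le (hf : IsSecretPolymatroid G f) (x : V) (X : Finset V) :
    f (insert x X) ≤ f {x} + f X := by
  have h := hf.submodular {x} X
  have h0 : 0 ≤ f ({x} ∩ X) := hf.empty_nonneg.trans (hf.mono (Finset.empty_subset _))
  rw [← Finset.insert_eq] at h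
  linarith

theorem add_one_le_of_adj (hf : IsSecretPolymatroid G f) {A B : Finset V} {a b : V}
    (hAB : Disjoint A B) (ha : a ∈ A) (hbA : b ∉ A) (hbB : b ∉ B) (hab : G.Adj a b)
    (hindep : G.IsIndepSet (insert b (A.erase a) : Finset V))
    (hdep : ¬ G.IsIndepSet (insert b B : Finset V)) :
    f (insert b (A ∪ B)) + f (A.erase a) + f B + 1 ≤
      f (insert b B) + f ((A ∪ B).erase a) + f A := by
  have haB : a ∉ B := Finset.disjoint_left.1 hAB ha
  have hAB' : ∀ x, x ∈ A → x ∉ B := fun _ => (Finset.disjoint_left.1 hAB ·)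
  have hbAB : insert b (B ∪ A.erase a) ∩ insert b A = insert b (A.erase a) := by grind
  have hgain := hf.strict_submodular (insert b (B ∪ A.erase a)) (insert b A)
    (fun h => hdep (h.mono (by gcongr; exact Finset.subset_union_left)))
    (fun h => h (by simp [ha]) (by simp) hab.ne hab) (by rwa [hbAB])
  have hA := hf.submodular A (insert b (A.erase a))
  have hB := hf.submodular (insert b B) ((A ∪ B).erase a)
  rw [hbAB, show insert b (B ∪ A.erase a) ∪ insert b A = insert b (A ∪ B) by grind] at hgain
  rw [show A ∪ insert b (A.erase a) = insert b A by grind,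
    show A ∩ insert b (A.erase a) = A.erase a by grind] at hA
  rw [show insert b B ∪ (A ∪ B).erase a = insert b (B ∪ A.erase a) by grind,
    show insert b B ∩ (A ∪ B).erase a = B by grind] at hB
  linarith

end IsSecretPolymatroid

section ColorGain

variable {V W : Type*} [Fintype V] [Fintype W] {G : SimpleGraph V} {H : SimpleGraph W}

/-- The vertices of color `p` in a 2-coloring of a finite graph. -/
def colorFinset (C : G.Coloring Bool) (p : Bool) : Finset V := {x | C x = p}

@[simp]
theorem mem_colorFinset {C : G.Coloring Bool} {p : Bool} {x : V} :
    x ∈ colorFinset C p ↔ C x = p := by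
  simp [colorFinset]

/-- The two colors are used equally often. -/
def IsBalanced (C : G.Coloring Bool) : Prop :=
  ∀ p, (colorFinset C (!p)).card = (colorFinset C p).card

theorem isIndepSet_colorFinset (C : G.Coloring Bool) (p : Bool) :
    G.IsIndepSet (colorFinset C p : Set V) := by
  simpa only [colorFinset, Finset.coe_filter_univ] using! C.isIndepSet_colorClass p

theorem not_isIndepSet_insert_colorFinset [DecidableEq V] (C : G.Coloring Bool) {p : Bool}
    {x y : V} (hx : x ∈ colorFinset C (!p)) (hxy : G.Adj x y) :
    ¬ G.IsIndepSet (insert x (colorFinset C p) : Finset V) := by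
  have hy : C y = p := by
    have h := C.valid hxy
    rw [mem_colorFinset.1 hx] at h
    exact Bool.eq_not.2 h.symm |>.trans (Bool.not_not p)
  exact fun h => h (by simp) (by simp [hy]) hxy.ne hxy

theorem sum_colorFinset_add_sum_colorFinset_not (C : G.Coloring Bool) (p : Bool) {M : Type*}
    [AddCommMonoid M] (g : V → M) :
    ∑ x ∈ colorFinset C p, g x + ∑ x ∈ colorFinset C (!p), g x = ∑ x, g x := by
  simpa only [colorFinset, Bool.eq_not] using Finset.sum_filter_add_sum_filter_not _ (C · = p) g

theorem IsBalanced.two_mul_card {C : G.Coloring Bool} (hC : IsBalanced C) (p : Bool) :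
    2 * (colorFinset C p).card = Fintype.card V := by
  have h := sum_colorFinset_add_sum_colorFinset_not C p fun _ => 1
  rw [← Finset.card_eq_sum_ones, ← Finset.card_eq_sum_ones, ← Finset.card_eq_sum_ones, hC p,
    Finset.card_univ] at h
  rw [two_mul, h]

/-- The inequality with gain `k` that is carried through the induction on the dimension of the
cube: it relates the sets obtained from a color class by adding a vertex of the other color and
those obtained by removing one of its own vertices. -/
def HasColorGain [DecidableEq V] (C : G.Coloring Bool) (k : ℝ) : Prop :=
  ∀ f, IsSecretPolymatroid G f → ∀ p,
    ∑ x ∈ colorFinset C (!p), f (insert x (colorFinset C p)) + k ≤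
      ∑ x ∈ colorFinset C p, f ((colorFinset C p).erase x) + ∑ x, f {x}

theorem IsBalanced.hasColorGain_zero [DecidableEq V] {C : G.Coloring Bool} (hC : IsBalanced C) :
    HasColorGain C 0 := fun f hf p => by
  set E := colorFinset C p
  have hinsert := Finset.sum_le_sum fun x (_ : x ∈ colorFinset C (!p)) => hf.apply_insert_le x E
  have herase := Finset.sum_le_sum fun x (hx : x ∈ E) => by
    simpa only [Finset.insert_erase hx] using hf.apply_insert_le x (E.erase x)
  rw [Finset.sum_add_distrib, Finset.sum_const, hC p] at hinsert
  rw [Finset.sum_add_distrib, Finset.sum_const] at herase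
  have hsplit := sum_colorFinset_add_sum_colorFinset_not C p fun x => f {x}
  linarith

theorem HasColorGain.add_half_card_le [DecidableEq V] {C : G.Coloring Bool} {k : ℝ}
    (h : HasColorGain C k) (hC : IsBalanced C) (hG : ∀ x, ∃ y, G.Adj x y)
    {f : Finset V → ℝ} (hf : IsSecretPolymatroid G f) :
    k + Fintype.card V / 2 ≤ ∑ x, f {x} := by
  set E := colorFinset C true with hE
  have hinsert := Finset.card_nsmul_le_sum (colorFinset C false) (fun x => f (insert x E)) (f E + 1)
    fun x hx => hf.strict_mono E _ (Finset.subset_insert x E) (isIndepSet_colorFinset C true)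
      (not_isIndepSet_insert_colorFinset C hx (hG x).choose_spec)
  have herase := Finset.sum_le_card_nsmul E (fun x => f (E.erase x)) (f E)
    fun x _ => hf.mono (E.erase_subset x)
  have hcard : (2 * E.card : ℝ) = Fintype.card V := mod_cast hC.two_mul_card true
  have hgain := h f hf true
  rw [nsmul_eq_mul, ← Bool.not_true, hC true, ← hE] at hinsert
  rw [nsmul_eq_mul] at herase
  linarith

theorem map_symm_colorFinset (C : G.Coloring Bool) (e : H ≃g G) (p : Bool) :
    (colorFinset C p).map e.symm.toEmbedding.toEmbedding = colorFinset (C.comap e.toHom) p := by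
  ext x
  simp only [Finset.mem_map, mem_colorFinset]
  constructor
  · rintro ⟨y, rfl, rfl⟩
    exact congrArg C (e.apply_symm_apply y)
  · exact fun h => ⟨e x, h, e.symm_apply_apply x⟩

theorem IsBalanced.of_iso {C : G.Coloring Bool} (hC : IsBalanced C) (e : H ≃g G) :
    IsBalanced (C.comap e.toHom) := fun p => by
  rw [← map_symm_colorFinset, ← map_symm_colorFinset, Finset.card_map, Finset.card_map, hC p]

theorem HasColorGain.of_iso [DecidableEq V] [DecidableEq W] {C : G.Coloring Bool} {k : ℝ}
    (h : HasColorGain C k) (e : H ≃g G) : HasColorGain (C.comap e.toHom) k := fun f hf p => by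
  have hgain := h _ (hf.comap e.symm.toEmbedding) p
  rw [← Equiv.sum_comp e.symm.toEquiv fun x => f {x}]
  simpa only [← map_symm_colorFinset, Finset.sum_map, Finset.map_insert, Finset.map_erase,
    Finset.map_singleton] using! hgain

/-- The coloring of the prism over `G` that uses `C` on the bottom copy of `G` and the opposite of
`C` on the top copy. -/
def prismColoring (C : G.Coloring Bool) : (G □ (⊤ : SimpleGraph Bool)).Coloring Bool :=
  SimpleGraph.Coloring.mk (fun z => xor (C z.1) z.2) fun {z w} h => by
    rcases h with ⟨h, hs⟩ | ⟨h, hx⟩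
    · simpa [hs] using C.valid h
    · simpa [hx] using h

theorem mem_colorFinset_prismColoring {C : G.Coloring Bool} {p : Bool} {z : V × Bool} :
    z ∈ colorFinset (prismColoring C) p ↔ z.1 ∈ colorFinset C (xor p z.2) := by
  rw [mem_colorFinset, mem_colorFinset]
  have h : ∀ a b q : Bool, xor a b = q ↔ a = xor q b := by decide
  exact h _ _ _

theorem sum_colorFinset_prismColoring (C : G.Coloring Bool) (p : Bool) {M : Type*}
    [AddCommMonoid M] (g : V × Bool → M) :
    ∑ z ∈ colorFinset (prismColoring C) p, g z =
      ∑ s, ∑ x ∈ colorFinset C (xor p s), g (x, s) :=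
  Finset.sum_finset_product_right _ Finset.univ (fun s => colorFinset C (xor p s))
    (fun z => by simp only [mem_colorFinset_prismColoring, Finset.mem_univ, true_and])

theorem isBalanced_prismColoring (C : G.Coloring Bool) : IsBalanced (prismColoring C) := fun p => by
  simp only [Finset.card_eq_sum_ones, sum_colorFinset_prismColoring, Fintype.sum_bool]
  simp [add_comm]

/-- The vertices of color `p` of the prism that lie in the copy of `G` with index `s`. -/
def prismFacet (C : G.Coloring Bool) (p s : Bool) : Finset (V × Bool) :=
  (colorFinset C (xor p s)).map (G.boxProdLeft ⊤ s).toEmbedding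

theorem mem_prismFacet {C : G.Coloring Bool} {p s : Bool} {z : V × Bool} :
    z ∈ prismFacet C p s ↔ z ∈ colorFinset (prismColoring C) p ∧ z.2 = s := by
  rw [mem_colorFinset_prismColoring, prismFacet, Finset.mem_map]
  constructor
  · rintro ⟨x, hx, rfl⟩
    exact ⟨hx, rfl⟩
  · rintro ⟨hz, rfl⟩
    exact ⟨z.1, hz, rfl⟩

variable [DecidableEq V]

theorem prismFacet_not_union_prismFacet (C : G.Coloring Bool) (p s : Bool) :
    prismFacet C p (!s) ∪ prismFacet C p s = colorFinset (prismColoring C) p := by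
  ext z
  simp only [Finset.mem_union, mem_prismFacet, ← and_or_left, Bool.eq_not, ne_or_eq, and_true]

theorem isIndepSet_insert_erase_prismFacet (C : G.Coloring Bool) (p s : Bool) (x : V) :
    (G □ (⊤ : SimpleGraph Bool)).IsIndepSet
      (insert (x, s) ((prismFacet C p (!s)).erase (x, !s)) : Finset (V × Bool)) := by
  rw [Finset.coe_insert, SimpleGraph.isIndepSet_iff]
  simp only [Set.pairwise_insert, SimpleGraph.adj_comm _ _ (x, s), and_self]
  refine ⟨(isIndepSet_colorFinset (prismColoring C) p).mono fun z hz => ?_, fun z hz _ h => ?_⟩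
  · exact (mem_prismFacet.1 (Finset.mem_of_mem_erase hz)).1
  · obtain ⟨hne, hz⟩ := Finset.mem_erase.1 hz
    have hs : z.2 = !s := (mem_prismFacet.1 hz).2
    rcases h with ⟨-, h⟩ | ⟨-, h⟩
    · simp [hs] at h
    · exact hne (Prod.ext h.symm hs)

theorem IsSecretPolymatroid.rung_gain {f : Finset (V × Bool) → ℝ}
    (hf : IsSecretPolymatroid (G □ (⊤ : SimpleGraph Bool)) f) (C : G.Coloring Bool)
    (hG : ∀ x, ∃ y, G.Adj x y) (p s : Bool) {x : V} (hx : x ∈ colorFinset C (!(xor p s))) :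
    f (insert (x, s) (colorFinset (prismColoring C) p)) +
        f ((prismFacet C p (!s)).erase (x, !s)) + f (prismFacet C p s) + 1 ≤
      f (insert (x, s) (prismFacet C p s)) +
        f ((colorFinset (prismColoring C) p).erase (x, !s)) + f (prismFacet C p (!s)) := by
  obtain ⟨y, hxy⟩ := hG x
  have hb : (x, s) ∉ colorFinset (prismColoring C) p := by
    rw [mem_colorFinset_prismColoring, mem_colorFinset, mem_colorFinset.1 hx]
    exact Bool.not_ne_self _
  rw [← prismFacet_not_union_prismFacet C p s]
  refine hf.add_one_le_of_adj ?_ ?_ (fun h => hb (mem_prismFacet.1 h).1)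
    (fun h => hb (mem_prismFacet.1 h).1) (by simp) (isIndepSet_insert_erase_prismFacet C p s x) ?_
  · refine Finset.disjoint_left.2 fun z hz hz' => ?_
    simpa [(mem_prismFacet.1 hz).2] using (mem_prismFacet.1 hz').2
  · exact mem_prismFacet.2 ⟨mem_colorFinset_prismColoring.2 (by rwa [Bool.xor_not]), rfl⟩
  · have h := (isIndepSet_map_iff (G.boxProdLeft ⊤ s) _).not.2
      (not_isIndepSet_insert_colorFinset C hx hxy)
    rwa [Finset.map_insert] at h

theorem HasColorGain.facet_gain {C : G.Coloring Bool} {k : ℝ} (h : HasColorGain C k)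
    {f : Finset (V × Bool) → ℝ} (hf : IsSecretPolymatroid (G □ (⊤ : SimpleGraph Bool)) f)
    (p s : Bool) :
    ∑ x ∈ colorFinset C (!(xor p s)), f (insert (x, s) (prismFacet C p s)) + k ≤
      ∑ x ∈ colorFinset C (xor p s), f ((prismFacet C p s).erase (x, s)) + ∑ x, f {(x, s)} := by
  simpa only [Finset.map_insert, Finset.map_erase, Finset.map_singleton] using!
    h _ (hf.comap (G.boxProdLeft ⊤ s)) (xor p s)

theorem HasColorGain.prism {C : G.Coloring Bool} {k : ℝ} (h : HasColorGain C k)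
    (hC : IsBalanced C) (hG : ∀ x, ∃ y, G.Adj x y) :
    HasColorGain (prismColoring C) (2 * k + Fintype.card V) := fun f hf p => by
  have hrung := fun s => Finset.sum_le_sum fun x hx => hf.rung_gain C hG p s (x := x) hx
  have hfacet := h.facet_gain hf p
  have hcard (q : Bool) : ((colorFinset C q).card : ℝ) = Fintype.card V / 2 :=
    eq_div_of_mul_eq two_ne_zero (by rw [mul_comm]; exact_mod_cast hC.two_mul_card q)
  simp only [Finset.sum_add_distrib, Finset.sum_const, nsmul_eq_mul, mul_one, hcard] at hrung
  have hrungTrue := hrung true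
  have hrungFalse := hrung false
  have hfacetTrue := hfacet true
  have hfacetFalse := hfacet false
  rw [sum_colorFinset_prismColoring, sum_colorFinset_prismColoring, Fintype.sum_prod_type_right,
    Fintype.sum_bool, Fintype.sum_bool, Fintype.sum_bool]
  simp only [Bool.xor_true, Bool.xor_false, Bool.not_true, Bool.not_false, Bool.not_not] at *
  linarith

end ColorGain

section Cube

theorem hammingDist_cons {d : ℕ} (s t : Bool) (x y : Fin d → Bool) :
    hammingDist (Fin.cons s x : Fin (d + 1) → Bool) (Fin.cons t y : Fin (d + 1) → Bool) =
      (if s ≠ t then 1 else 0) + hammingDist x y := by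
  simp only [hammingDist, Finset.card_filter, Fin.sum_univ_succ, Fin.cons_zero, Fin.cons_succ]

/-- The `(d + 1)`-dimensional cube as the prism over the `d`-dimensional one. -/
def cubeGraphSuccIso (d : ℕ) : cubeGraph (d + 1) ≃g cubeGraph d □ (⊤ : SimpleGraph Bool) :=
  .symm {
    toEquiv := (Equiv.prodComm _ _).trans (Fin.consEquiv fun _ => Bool)
    map_rel_iff' := by
      rintro ⟨x, s⟩ ⟨y, t⟩
      change hammingDist (Fin.cons s x : Fin (d + 1) → Bool) (Fin.cons t y) = 1 ↔
        hammingDist x y = 1 ∧ s = t ∨ s ≠ t ∧ x = y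
      by_cases h : s = t <;> simp [hammingDist_cons, h] }

theorem exists_adj_cubeGraph_succ {d : ℕ} (x : Fin (d + 1) → Bool) :
    ∃ y, (cubeGraph (d + 1)).Adj x y := by
  let e := cubeGraphSuccIso d
  have h : (cubeGraph d □ (⊤ : SimpleGraph Bool)).Adj (e x) ((e x).1, !(e x).2) := by simp
  exact ⟨e.symm ((e x).1, !(e x).2), by rwa [← e.map_adj_iff, e.apply_symm_apply]⟩

theorem exists_hasColorGain_cubeGraph (d : ℕ) :
    ∃ C : (cubeGraph (d + 1)).Coloring Bool, IsBalanced C ∧ HasColorGain C (d * 2 ^ d) := by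
  induction d with
  | zero =>
    let C : (cubeGraph 0).Coloring Bool :=
      .mk (fun _ => true) fun {x y} h => ((cubeGraph 0).ne_of_adj h (Subsingleton.elim x y)).elim
    have hC := (isBalanced_prismColoring C).of_iso (cubeGraphSuccIso 0)
    exact ⟨_, hC, by simpa using hC.hasColorGain_zero⟩
  | succ d ih =>
    obtain ⟨C, hC, hgain⟩ := ih
    refine ⟨_, (isBalanced_prismColoring C).of_iso (cubeGraphSuccIso (d + 1)), ?_⟩
    convert (hgain.prism hC exists_adj_cubeGraph_succ).of_iso (cubeGraphSuccIso (d + 1)) using 1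
    simp only [Fintype.card_pi, Fintype.card_bool, Finset.prod_const, Finset.card_univ,
      Fintype.card_fin, Nat.cast_pow, Nat.cast_succ]
    ring

theorem IsSecretPolymatroid.half_mul_two_pow_le_sum_singleton {d : ℕ}
    {f : Finset (Fin d → Bool) → ℝ} (hf : IsSecretPolymatroid (cubeGraph d) f) :
    (d / 2 : ℝ) * 2 ^ d ≤ ∑ x, f {x} := by
  cases d with
  | zero =>
    simpa using hf.empty_nonneg.trans (hf.mono (Finset.empty_subset _))
  | succ d =>
    obtain ⟨C, hC, hgain⟩ := exists_hasColorGain_cubeGraph d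
    have h := hgain.add_half_card_le hC exists_adj_cubeGraph_succ hf
    simp only [Fintype.card_pi, Fintype.card_bool, Finset.prod_const, Finset.card_univ,
      Fintype.card_fin] at h
    push_cast at h ⊢
    rw [pow_succ] at h ⊢
    linarith

end Cube

namespace PerfectSecretSharingScheme

variable {V : Type*} {G : SimpleGraph V} (𝒮 : PerfectSecretSharingScheme G)

/-- The shares of a finite set of vertices, as one random variable. -/
def jointShare (X : Finset V) (ω : 𝒮.Ω) (v : X) : 𝒮.Share v := 𝒮.share v ω

theorem measurable_jointShare (X : Finset V) : Measurable (𝒮.jointShare X) :=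
  measurable_pi_lambda _ fun v => 𝒮.measurable_share v

theorem indepFun_secret_jointShare {X : Finset V} (hX : G.IsIndepSet (X : Set V)) :
    IndepFun 𝒮.secret (𝒮.jointShare X) 𝒮.μ :=
  𝒮.indep_of_isIndepSet X hX

theorem exists_decode {X : Finset V} (hX : ¬ G.IsIndepSet (X : Set V)) :
    ∃ g : (∀ v : X, 𝒮.Share v) → 𝒮.Secret, ∀ᵐ ω ∂𝒮.μ, 𝒮.secret ω = g (𝒮.jointShare X ω) := by
  simp only [SimpleGraph.isIndepSet_iff, Set.Pairwise, not_forall, not_not] at hX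
  obtain ⟨v, hv, w, hw, -, hadj⟩ := hX
  obtain ⟨decode, h⟩ := 𝒮.edge_determines v w hadj
  exact ⟨fun s => decode (s ⟨v, hv⟩) (s ⟨w, hw⟩), h⟩

theorem ratio_nonneg : 0 ≤ 𝒮.ratio :=
  Real.iSup_nonneg fun _ => div_nonneg (shannonEntropy_nonneg _) 𝒮.entropy_secret_pos.le

section Polymatroid

variable [DecidableEq V]

theorem shannonEntropy_secret_jointShare_of_not_isIndepSet {X : Finset V}
    (hX : ¬ G.IsIndepSet (X : Set V)) :
    shannonEntropy 𝒮.μ (fun ω => (𝒮.secret ω, 𝒮.jointShare X ω)) =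
      shannonEntropy 𝒮.μ (𝒮.jointShare X) := by
  obtain ⟨g, hg⟩ := 𝒮.exists_decode hX
  exact shannonEntropy_prodMk_of_ae_eq g hg

theorem shannonEntropy_secret_jointShare_of_isIndepSet {X : Finset V}
    (hX : G.IsIndepSet (X : Set V)) :
    shannonEntropy 𝒮.μ (fun ω => (𝒮.secret ω, 𝒮.jointShare X ω)) =
      shannonEntropy 𝒮.μ 𝒮.secret + shannonEntropy 𝒮.μ (𝒮.jointShare X) :=
  shannonEntropy_prodMk_of_indepFun 𝒮.measurable_secret (𝒮.measurable_jointShare X)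
    (𝒮.indepFun_secret_jointShare hX)

section Auxiliary

variable {U : Type*} [Fintype U] [MeasurableSpace U] [MeasurableSingletonClass U] {W : 𝒮.Ω → U}

theorem shannonEntropy_prodMk_jointShare_mono (hW : Measurable W) :
    Monotone fun X => shannonEntropy 𝒮.μ (fun ω => (W ω, 𝒮.jointShare X ω)) := fun _ Y h =>
  shannonEntropy_le_of_ae_eq (hW.prodMk (𝒮.measurable_jointShare Y))
    (fun s => (s.1, fun v => s.2 ⟨v, h v.2⟩)) (ae_of_all _ fun _ => rfl)

theorem shannonEntropy_prodMk_jointShare_submodular (hW : Measurable W) (X Y : Finset V) :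
    shannonEntropy 𝒮.μ (fun ω => (W ω, 𝒮.jointShare (X ∪ Y) ω)) +
        shannonEntropy 𝒮.μ (fun ω => (W ω, 𝒮.jointShare (X ∩ Y) ω)) ≤
      shannonEntropy 𝒮.μ (fun ω => (W ω, 𝒮.jointShare X ω)) +
        shannonEntropy 𝒮.μ (fun ω => (W ω, 𝒮.jointShare Y ω)) := by
  refine shannonEntropy_add_le_of_determined
    (hW.prodMk (𝒮.measurable_jointShare X)) (hW.prodMk (𝒮.measurable_jointShare Y))
    (fun s t => (s.1, fun v => if h : v.1 ∈ X then s.2 ⟨v, h⟩ else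
      t.2 ⟨v, (Finset.mem_union.1 v.2).resolve_left h⟩))
    (fun ω => Prod.ext rfl (funext fun v => ?_))
    (fun s => (s.1, fun v => s.2 ⟨v, (Finset.mem_inter.1 v.2).1⟩)) (fun _ => rfl)
    (fun t => (t.1, fun v => t.2 ⟨v, (Finset.mem_inter.1 v.2).2⟩)) (fun _ => rfl)
  by_cases h : v.1 ∈ X <;> simp [h, jointShare]

end Auxiliary

theorem shannonEntropy_unit_jointShare (X : Finset V) :
    shannonEntropy 𝒮.μ (fun ω => ((), 𝒮.jointShare X ω)) =
      shannonEntropy 𝒮.μ (𝒮.jointShare X) :=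
  shannonEntropy_prodMk_of_ae_eq (fun _ => ()) (ae_of_all _ fun _ => rfl)

theorem shannonEntropy_jointShare_mono :
    Monotone fun X => shannonEntropy 𝒮.μ (𝒮.jointShare X) := by
  simpa only [shannonEntropy_unit_jointShare] using
    𝒮.shannonEntropy_prodMk_jointShare_mono (W := fun _ => ()) measurable_const

theorem shannonEntropy_jointShare_submodular (X Y : Finset V) :
    shannonEntropy 𝒮.μ (𝒮.jointShare (X ∪ Y)) + shannonEntropy 𝒮.μ (𝒮.jointShare (X ∩ Y)) ≤
      shannonEntropy 𝒮.μ (𝒮.jointShare X) + shannonEntropy 𝒮.μ (𝒮.jointShare Y) := by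
  simpa only [shannonEntropy_unit_jointShare] using
    𝒮.shannonEntropy_prodMk_jointShare_submodular (W := fun _ => ()) measurable_const X Y

theorem shannonEntropy_jointShare_add_secret_le {X Y : Finset V} (h : X ⊆ Y)
    (hX : G.IsIndepSet (X : Set V)) (hY : ¬ G.IsIndepSet (Y : Set V)) :
    shannonEntropy 𝒮.μ (𝒮.jointShare X) + shannonEntropy 𝒮.μ 𝒮.secret ≤
      shannonEntropy 𝒮.μ (𝒮.jointShare Y) := by
  rw [add_comm, ← 𝒮.shannonEntropy_secret_jointShare_of_isIndepSet hX,
    ← 𝒮.shannonEntropy_secret_jointShare_of_not_isIndepSet hY]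
  exact 𝒮.shannonEntropy_prodMk_jointShare_mono 𝒮.measurable_secret h

theorem shannonEntropy_jointShare_union_add_inter_add_secret_le {X Y : Finset V}
    (hX : ¬ G.IsIndepSet (X : Set V)) (hY : ¬ G.IsIndepSet (Y : Set V))
    (hXY : G.IsIndepSet ((X ∩ Y : Finset V) : Set V)) :
    shannonEntropy 𝒮.μ (𝒮.jointShare (X ∪ Y)) + shannonEntropy 𝒮.μ (𝒮.jointShare (X ∩ Y)) +
        shannonEntropy 𝒮.μ 𝒮.secret ≤
      shannonEntropy 𝒮.μ (𝒮.jointShare X) + shannonEntropy 𝒮.μ (𝒮.jointShare Y) := by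
  have hunion : ¬ G.IsIndepSet ((X ∪ Y : Finset V) : Set V) :=
    fun h => hX (h.mono (by simp))
  have h := 𝒮.shannonEntropy_prodMk_jointShare_submodular 𝒮.measurable_secret X Y
  rw [𝒮.shannonEntropy_secret_jointShare_of_isIndepSet hXY,
    𝒮.shannonEntropy_secret_jointShare_of_not_isIndepSet hX,
    𝒮.shannonEntropy_secret_jointShare_of_not_isIndepSet hY,
    𝒮.shannonEntropy_secret_jointShare_of_not_isIndepSet hunion] at h
  linarith

theorem isSecretPolymatroid : IsSecretPolymatroid G (fun X =>
    shannonEntropy 𝒮.μ (𝒮.jointShare X) / shannonEntropy 𝒮.μ 𝒮.secret) := by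
  have hpos := 𝒮.entropy_secret_pos
  have hone : 1 = shannonEntropy 𝒮.μ 𝒮.secret / shannonEntropy 𝒮.μ 𝒮.secret :=
    (div_self hpos.ne').symm
  refine ⟨div_nonneg (shannonEntropy_nonneg _) hpos.le, fun X Y h => ?_, fun X Y => ?_,
    fun X Y h hX hY => ?_, fun X Y hX hY hXY => ?_⟩
  · exact div_le_div_of_nonneg_right (𝒮.shannonEntropy_jointShare_mono h) hpos.le
  · simpa only [← add_div] using
      div_le_div_of_nonneg_right (𝒮.shannonEntropy_jointShare_submodular X Y) hpos.le
  · rw [hone, ← add_div]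
    exact div_le_div_of_nonneg_right (𝒮.shannonEntropy_jointShare_add_secret_le h hX hY) hpos.le
  · rw [hone, ← add_div, ← add_div, ← add_div]
    exact div_le_div_of_nonneg_right
      (𝒮.shannonEntropy_jointShare_union_add_inter_add_secret_le hX hY hXY) hpos.le

theorem shannonEntropy_jointShare_singleton_le (v : V) :
    shannonEntropy 𝒮.μ (𝒮.jointShare {v}) ≤ shannonEntropy 𝒮.μ (𝒮.share v) :=
  shannonEntropy_le_of_ae_eq (𝒮.measurable_share v)
    (fun s w => (Finset.mem_singleton.1 w.2).symm ▸ s) <| ae_of_all _ fun ω => by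
      funext ⟨w, hw⟩
      obtain rfl := Finset.mem_singleton.1 hw
      rfl

theorem shannonEntropy_jointShare_singleton_div_le_ratio [Finite V] (v : V) :
    shannonEntropy 𝒮.μ (𝒮.jointShare {v}) / shannonEntropy 𝒮.μ 𝒮.secret ≤ 𝒮.ratio :=
  (div_le_div_of_nonneg_right (𝒮.shannonEntropy_jointShare_singleton_le v)
    𝒮.entropy_secret_pos.le).trans (le_ciSup
    (f := fun w => shannonEntropy 𝒮.μ (𝒮.share w) / shannonEntropy 𝒮.μ 𝒮.secret)
    (Set.finite_range _).bddAbove v)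

end Polymatroid

theorem half_le_ratio_of_cubeGraph_embedding [Finite V] {d : ℕ} (φ : cubeGraph d ↪g G) :
    (d / 2 : ℝ) ≤ 𝒮.ratio := by
  classical
  have hsum := (𝒮.isSecretPolymatroid.comap φ).half_mul_two_pow_le_sum_singleton.trans
    (Finset.sum_le_sum fun x _ => 𝒮.shannonEntropy_jointShare_singleton_div_le_ratio (φ x))
  rw [Finset.sum_const, Finset.card_univ, Fintype.card_fun, Fintype.card_bool, Fintype.card_fin,
    nsmul_eq_mul, Nat.cast_pow, Nat.cast_ofNat, mul_comm] at hsum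
  exact le_of_mul_le_mul_left hsum (by positivity)

end PerfectSecretSharingScheme

section OneTimePad

variable {R T T' : Type*} [MeasurableSpace R] [MeasurableSpace T] [MeasurableSpace T']

theorem indepFun_fst_uncurry_of_measurePreserving {μ : Measure R} {ν : Measure T}
    {ν' : Measure T'} [IsProbabilityMeasure μ] [IsProbabilityMeasure ν] {f : R → T → T'}
    (hf : Measurable f.uncurry) (h : ∀ᵐ r ∂μ, MeasurePreserving (f r) ν ν') :
    IndepFun Prod.fst f.uncurry (μ.prod ν) := by
  have hskew : MeasurePreserving (fun ω : R × T => (ω.1, f ω.1 ω.2)) (μ.prod ν) (μ.prod ν') :=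
    (MeasurePreserving.id μ).skew_product hf (h.mono fun _ hr => hr.map_eq)
  obtain ⟨r, hr⟩ := h.exists
  have : IsProbabilityMeasure ν' :=
    hr.map_eq ▸ Measure.isProbabilityMeasure_map hr.measurable.aemeasurable
  have hsnd : (μ.prod ν).map f.uncurry = ν' := (measurePreserving_snd.comp hskew).map_eq
  rw [indepFun_iff_map_prod_eq_prod_map_map measurable_fst.aemeasurable hf.aemeasurable,
    measurePreserving_fst.map_eq, hsnd]
  exact hskew.map_eq

instance isProbabilityMeasure_uniformOn_univ [Finite T] [Nonempty T] [MeasurableSingletonClass T] :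
    IsProbabilityMeasure (uniformOn (Set.univ : Set T)) :=
  isProbabilityMeasure_uniformOn Set.finite_univ Set.univ_nonempty

theorem measurePreserving_uniformOn_univ [Finite T] [DiscreteMeasurableSpace T] {f : T → T}
    (hf : f.Bijective) : MeasurePreserving f (uniformOn Set.univ) (uniformOn Set.univ) := by
  cases nonempty_fintype T
  refine ⟨.of_discrete, Measure.ext fun s hs => ?_⟩
  rw [Measure.map_apply .of_discrete hs, uniformOn_univ, uniformOn_univ,
    Measure.count_apply .of_discrete, Measure.count_apply hs, Set.encard_preimage_of_bijective hf]

theorem shannonEntropy_fst_uniformOn_univ [Fintype R] [DiscreteMeasurableSpace R] [Nonempty R]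
    (ν : Measure T) [IsProbabilityMeasure ν] :
    shannonEntropy ((uniformOn (Set.univ : Set R)).prod ν) Prod.fst =
      Real.logb 2 (Fintype.card R) := by
  have hfst (r : R) : ((uniformOn (Set.univ : Set R)).prod ν).real (Prod.fst ⁻¹' {r}) =
      (Fintype.card R : ℝ)⁻¹ := by
    rw [← Set.prod_univ, measureReal_prod_prod]
    simp [measureReal_def, uniformOn_univ]
  simp only [shannonEntropy, hfst, Real.negMulLog, Real.log_inv, Finset.sum_const,
    Finset.card_univ, nsmul_eq_mul, Real.logb]
  field_simp

end OneTimePad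

/-- A cover of the edges of `G` by complete bipartite subgraphs: every vertex in `left i` is
adjacent to every vertex in `right i`, and these are all the edges. -/
structure BicliqueCover {V : Type*} (G : SimpleGraph V) (I : Type*) where
  left : I → Set V
  right : I → Set V
  adj : ∀ i, ∀ v ∈ left i, ∀ w ∈ right i, G.Adj v w
  cover : ∀ v w, G.Adj v w → ∃ i, v ∈ left i ∧ w ∈ right i ∨ v ∈ right i ∧ w ∈ left i

namespace BicliqueCover

variable {V : Type*} {G : SimpleGraph V} {I : Type*} (C : BicliqueCover G I)

/-- The bicliques that contain the vertex `v`. -/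
def index (v : V) : Set I := {i | v ∈ C.left i ∪ C.right i}

open Classical in
/-- The share of `v` in the scheme that masks the secret bit `s` with one random bit `r i` for each
biclique: `left i` is given `r i`, and `right i` is given `r i + s`. -/
noncomputable def maskedShare (v : V) (ω : Bool × (I → Bool)) (i : C.index v) : Bool :=
  xor (ω.2 i) (ω.1 && decide (v ∈ C.right i))

open Classical in
/-- The masks `r` as they are seen by the vertices of `X` when the secret bit is `s`. -/
noncomputable def shiftMask (X : Set V) (s : Bool) (r : I → Bool) (i : I) : Bool :=
  xor (r i) (s && decide (∃ v ∈ X, v ∈ C.right i))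

theorem notMem_right_of_mem_left {v : V} {i : I} (hv : v ∈ C.left i) : v ∉ C.right i :=
  fun hv' => (C.adj i v hv v hv').ne rfl

theorem exists_decode_maskedShare {v w : V} (h : G.Adj v w) :
    ∃ decode : (C.index v → Bool) → (C.index w → Bool) → Bool,
      ∀ ω, ω.1 = decode (C.maskedShare v ω) (C.maskedShare w ω) := by
  obtain ⟨i, hi⟩ := C.cover v w h
  have hv : i ∈ C.index v := hi.imp And.left And.left
  have hw : i ∈ C.index w := hi.symm.imp And.right And.right
  refine ⟨fun s t => xor (s ⟨i, hv⟩) (t ⟨i, hw⟩), fun ω => ?_⟩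
  rcases hi with ⟨hvl, hwr⟩ | ⟨hvr, hwl⟩
  · simp [maskedShare, hwr, C.notMem_right_of_mem_left hvl]
  · simp [maskedShare, hvr, C.notMem_right_of_mem_left hwl, Bool.xor_left_comm]

theorem shiftMask_involutive (X : Set V) (s : Bool) : (C.shiftMask X s).Involutive := fun r => by
  funext i
  simp [shiftMask]

theorem maskedShare_eq_shiftMask {X : Set V} (hX : G.IsIndepSet X) (ω : Bool × (I → Bool)) (v : X)
    (i : C.index v) : C.maskedShare v ω i = C.shiftMask X ω.1 ω.2 i := by
  have h : (v : V) ∈ C.right i ↔ ∃ w ∈ X, w ∈ C.right i := by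
    refine ⟨fun hv => ⟨v, v.2, hv⟩, fun ⟨w, hwX, hw⟩ => i.2.resolve_left fun hv => ?_⟩
    have hadj := C.adj i v hv w hw
    exact hX v.2 hwX hadj.ne hadj
  exact congrArg (fun b => xor (ω.2 i) (ω.1 && b)) (decide_eq_decide.2 h)

theorem indepFun_fst_maskedShare [Finite I] {X : Set V} (hX : G.IsIndepSet X) :
    IndepFun Prod.fst (fun ω (v : X) => C.maskedShare v ω)
      ((uniformOn (Set.univ : Set Bool)).prod (uniformOn (Set.univ : Set (I → Bool)))) := by
  have hindep := indepFun_fst_uncurry_of_measurePreserving (μ := uniformOn Set.univ)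
    (f := C.shiftMask X) .of_discrete (ae_of_all _ fun s =>
      measurePreserving_uniformOn_univ (C.shiftMask_involutive X s).bijective)
  have hshare : (fun ω (v : X) => C.maskedShare v ω) =
      (fun (r : I → Bool) (v : X) (i : C.index v) => r i) ∘ (C.shiftMask X).uncurry := by
    funext ω v i
    exact C.maskedShare_eq_shiftMask hX ω v i
  rw [hshare]
  exact hindep.comp measurable_id .of_discrete

section Scheme

variable {I : Type} [Finite I] (C : BicliqueCover G I)

/-- The perfect secret sharing scheme of a biclique cover: the secret is a uniform bit, masked with
an independent uniform bit for each biclique. -/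
noncomputable def scheme : PerfectSecretSharingScheme G where
  Ω := Bool × (I → Bool)
  μ := (uniformOn Set.univ).prod (uniformOn Set.univ)
  isProbabilityMeasure := inferInstance
  Secret := Bool
  Share v := C.index v → Bool
  fintypeShare _ := Fintype.ofFinite _
  secret := Prod.fst
  measurable_secret := measurable_fst
  share := C.maskedShare
  measurable_share _ := .of_discrete
  edge_determines _ _ h :=
    let ⟨decode, hdecode⟩ := C.exists_decode_maskedShare h
    ⟨decode, ae_of_all _ hdecode⟩
  indep_of_isIndepSet _ hX := C.indepFun_fst_maskedShare hX
  entropy_secret_pos := by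
    rw [shannonEntropy_fst_uniformOn_univ]
    simp

theorem shannonEntropy_secret_scheme : shannonEntropy C.scheme.μ C.scheme.secret = 1 :=
  (shannonEntropy_fst_uniformOn_univ (R := Bool) (uniformOn Set.univ)).trans (by simp)

theorem shannonEntropy_share_scheme_le (v : V) :
    shannonEntropy C.scheme.μ (C.scheme.share v) ≤ (C.index v).ncard := by
  refine (shannonEntropy_le_logb_card (C.scheme.measurable_share v)).trans_eq ?_
  have hcard : Fintype.card (C.scheme.Share v) = 2 ^ (C.index v).ncard := by
    rw [← Nat.card_eq_fintype_card]
    change Nat.card (C.index v → Bool) = _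
    simp [Nat.card_fun, Nat.card_coe_set_eq]
  simp [hcard, Real.logb_pow]

theorem ratio_scheme_le {c : ℕ} (hc : ∀ v, (C.index v).ncard ≤ c) : C.scheme.ratio ≤ c :=
  Real.iSup_le (fun v => by
    rw [C.shannonEntropy_secret_scheme, div_one]
    exact (C.shannonEntropy_share_scheme_le v).trans (mod_cast hc v)) c.cast_nonneg

theorem informationRatio_le {c : ℕ} (hc : ∀ v, (C.index v).ncard ≤ c) : informationRatio G ≤ c :=
  (ciInf_le ⟨0, Set.forall_mem_range.2 fun 𝒮 => 𝒮.ratio_nonneg⟩ C.scheme).trans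
    (C.ratio_scheme_le hc)

end Scheme

/-- The cover of the edges of a graph by the stars around its vertices. -/
def star (G : SimpleGraph V) : BicliqueCover G V where
  left v := {v}
  right := G.neighborSet
  adj := by
    rintro v _ rfl w h
    exact h
  cover v _ h := ⟨v, .inl ⟨rfl, h⟩⟩

end BicliqueCover

theorem half_le_informationRatio_of_cubeGraph_embedding {V : Type} [Finite V] {G : SimpleGraph V}
    {d : ℕ} (φ : cubeGraph d ↪g G) : (d / 2 : ℝ) ≤ informationRatio G := by
  have : Nonempty (PerfectSecretSharingScheme G) := ⟨(BicliqueCover.star G).scheme⟩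
  exact le_ciInf fun 𝒮 => 𝒮.half_le_ratio_of_cubeGraph_embedding φ

section BlockCover

variable {V J : Type} [Fintype V] [DecidableEq J] (G : SimpleGraph V) [DecidableRel G.Adj]
  (β : V → J)

/-- The neighbors of `v` in the block `j` of the partition of the vertices into the fibers of
`β`. -/
def blockNeighbors (j : J) (v : V) : Finset V := {u | β u = j ∧ G.Adj u v}

/-- The cover of the edges of `G` by the bicliques that join a subset `S` of a block `j` to the
vertices whose set of neighbors in this block is `S`. -/
def blockCover : BicliqueCover G (J × Finset V) where
  left i := {v | v ∈ i.2 ∧ ∀ u ∈ i.2, β u = i.1}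
  right i := {v | blockNeighbors G β i.1 v = i.2}
  adj := by
    intro i v hv w hw
    have hv : v ∈ blockNeighbors G β i.1 w := hw.symm ▸ hv.1
    exact (Finset.mem_filter.1 hv).2.2
  cover v w h := by
    refine ⟨(β v, blockNeighbors G β (β v) w), .inl ⟨⟨?_, fun u hu => ?_⟩, rfl⟩⟩
    · exact Finset.mem_filter.2 ⟨Finset.mem_univ v, rfl, h⟩
    · exact (Finset.mem_filter.1 hu).2.1

theorem ncard_left_blockCover_le {k : ℕ} {v : V} (hk : {u | β u = β v}.ncard ≤ k) :
    {i | v ∈ (blockCover G β).left i}.ncard ≤ 2 ^ (k - 1) := by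
  classical
  set F : Finset V := {u | β u = β v} with hF
  have hsub : {i | v ∈ (blockCover G β).left i} ⊆
      ((F.erase v).powerset.image fun S => (β v, insert v S) : Finset (J × Finset V)) := by
    rintro ⟨j, S⟩ ⟨hv, hS⟩
    obtain rfl : β v = j := hS v hv
    refine Finset.mem_coe.2 (Finset.mem_image.2 ⟨S.erase v, ?_, by simp [Finset.insert_erase hv]⟩)
    exact Finset.mem_powerset.2
      (Finset.erase_subset_erase v fun u hu => by simpa [hF] using hS u hu)
  have hcard : F.card ≤ k := by
    rwa [← Set.ncard_coe_finset, hF, Finset.coe_filter_univ]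
  calc {i | v ∈ (blockCover G β).left i}.ncard
      ≤ ((F.erase v).powerset.image fun S => (β v, insert v S)).card := by
        rw [← Set.ncard_coe_finset]
        exact Set.ncard_le_ncard hsub
    _ ≤ 2 ^ (F.erase v).card := Finset.card_image_le.trans_eq (Finset.card_powerset _)
    _ ≤ 2 ^ (k - 1) := by
        rw [Finset.card_erase_of_mem (by simp [hF])]
        gcongr
        exact one_le_two

theorem ncard_right_blockCover (v : V) :
    {i | v ∈ (blockCover G β).right i}.ncard = Nat.card J := by
  have hrange : {i | v ∈ (blockCover G β).right i} =
      Set.range fun j => (j, blockNeighbors G β j v) := by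
    ext ⟨j, S⟩
    simp [blockCover]
  rw [hrange, ← Set.image_univ, Set.ncard_image_of_injective _ fun _ _ h => congrArg Prod.fst h,
    Set.ncard_univ]

end BlockCover

theorem informationRatio_le_of_fibers {V J : Type} [Finite V] [Finite J] (G : SimpleGraph V)
    (β : V → J) {k : ℕ} (hk : ∀ j, {u | β u = j}.ncard ≤ k) :
    informationRatio G ≤ (2 ^ (k - 1) + Nat.card J : ℕ) := by
  classical
  cases nonempty_fintype V
  exact (blockCover G β).informationRatio_le fun v =>
    (Set.ncard_union_le _ _).trans
      (add_le_add (ncard_left_blockCover_le G β (hk _)) (ncard_right_blockCover G β v).le)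

theorem ncard_setOf_div_eq_le (n j : ℕ) {k : ℕ} (hk : 0 < k) :
    {u : Fin n | (u : ℕ) / k = j}.ncard ≤ k := by
  calc {u : Fin n | (u : ℕ) / k = j}.ncard
      ≤ (Finset.Ico (j * k) (j * k + k) : Set ℕ).ncard := by
        refine Set.ncard_le_ncard_of_injOn Fin.val (fun u hu => ?_) Fin.val_injective.injOn
        have hmem := (Nat.div_eq_iff hk).1 hu
        rw [Finset.coe_Ico, Set.mem_Ico]
        omega
    _ = k := by rw [Set.ncard_coe_finset, Nat.card_Ico, Nat.add_sub_cancel_left]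

theorem informationRatio_le_two_pow_add_div {n : ℕ} (G : SimpleGraph (Fin n)) {k : ℕ}
    (hk : 0 < k) : informationRatio G ≤ (2 ^ (k - 1) + (n / k + 1) : ℕ) := by
  let block (u : Fin n) : Fin (n / k + 1) :=
    ⟨u / k, Nat.lt_succ_of_le (Nat.div_le_div_right u.isLt.le)⟩
  have hblock (j : Fin (n / k + 1)) : {u | block u = j}.ncard ≤ k := by
    simpa only [block, Fin.ext_iff] using ncard_setOf_div_eq_le n j hk
  simpa only [Nat.card_fin] using informationRatio_le_of_fibers G block hblock

theorem two_pow_ceil_half_logb_sub_one_le_sqrt {x : ℝ} (hx : 1 ≤ x) :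
    (2 : ℝ) ^ (⌈Real.logb 2 x / 2⌉₊ - 1) ≤ √x := by
  have hlog : 0 ≤ Real.logb 2 x := Real.logb_nonneg one_lt_two hx
  have hexp : ((⌈Real.logb 2 x / 2⌉₊ - 1 : ℕ) : ℝ) ≤ Real.logb 2 x * (1 / 2) := by
    rw [← div_eq_mul_one_div, ← Nat.le_floor_iff (by positivity)]
    exact Nat.sub_le_of_le_add (Nat.ceil_le_floor_add_one _)
  calc (2 : ℝ) ^ (⌈Real.logb 2 x / 2⌉₊ - 1)
      = 2 ^ ((⌈Real.logb 2 x / 2⌉₊ - 1 : ℕ) : ℝ) := (Real.rpow_natCast _ _).symm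
    _ ≤ 2 ^ (Real.logb 2 x * (1 / 2)) := Real.rpow_le_rpow_of_exponent_le one_le_two hexp
    _ = √x := by
        rw [Real.rpow_mul zero_le_two, Real.rpow_logb two_pos (by norm_num) (by linarith),
          Real.sqrt_eq_rpow]

theorem one_add_sqrt_mul_logb_le {x : ℝ} (hx : 2 ≤ x) : (1 + √x) * Real.logb 2 x ≤ 2 * x := by
  have hsq : √x ^ 2 = x := Real.sq_sqrt (by linarith)
  have hsqrt : 7 / 5 ≤ √x := Real.le_sqrt_of_sq_le (by linarith)
  have hexp : Real.exp 1 * Real.log √x ≤ √x := by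
    simpa only [Real.exp_log (by linarith : 0 < √x)] using
      Real.exp_one_mul_le_exp (x := Real.log √x)
  have hlog : Real.log √x ≤ 2 / 5 * √x := by
    have hlog_nonneg : 0 ≤ Real.log √x := Real.log_nonneg (by linarith)
    nlinarith [Real.exp_one_gt_d9]
  have hlogb : Real.logb 2 x = 2 * Real.log √x / Real.log 2 := by
    rw [Real.log_sqrt (by linarith), Real.logb]
    ring
  rw [hlogb, mul_div_assoc', div_le_iff₀ (Real.log_pos one_lt_two)]
  calc (1 + √x) * (2 * Real.log √x)
      ≤ (1 + √x) * (2 * (2 / 5 * √x)) := by gcongr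
    _ ≤ 2 * x * (69 / 100) := by nlinarith
    _ ≤ 2 * x * Real.log 2 := by gcongr; linarith [Real.log_two_gt_d9]

theorem largestInformationRatio_le {n : ℕ} (hn : 2 ≤ n) :
    largestInformationRatio n ≤ 4 * (n / Real.logb 2 n) := by
  have hn' : (2 : ℝ) ≤ n := mod_cast hn
  have hlog : 0 < Real.logb 2 n := Real.logb_pos one_lt_two (by linarith)
  set k := ⌈Real.logb 2 n / 2⌉₊
  have hblocks : ((n / k : ℕ) : ℝ) ≤ 2 * (n / Real.logb 2 n) := by
    calc ((n / k : ℕ) : ℝ) ≤ n / k := Nat.cast_div_le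
      _ ≤ n / (Real.logb 2 n / 2) := by gcongr; exact Nat.le_ceil _
      _ = 2 * (n / Real.logb 2 n) := by field_simp
  have hsubsets : (2 : ℝ) ^ (k - 1) ≤ √n := two_pow_ceil_half_logb_sub_one_le_sqrt (by linarith)
  have hsqrt : 1 + √n ≤ 2 * (n / Real.logb 2 n) := by
    rw [← mul_div_assoc, le_div_iff₀ hlog]
    exact one_add_sqrt_mul_logb_le hn'
  refine ciSup_le fun G => ?_
  calc informationRatio G ≤ (2 ^ (k - 1) + (n / k + 1) : ℕ) :=
        informationRatio_le_two_pow_add_div G (Nat.ceil_pos.2 (half_pos hlog))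
    _ ≤ 4 * (n / Real.logb 2 n) := by
        push_cast
        linarith

theorem half_logb_le_informationRatio {V : Type} [Finite V] {G : SimpleGraph V} {d : ℕ}
    (φ : cubeGraph d ↪g G) : 0.5 * Real.logb 2 ((2 ^ d : ℕ) : ℝ) ≤ informationRatio G := by
  refine le_of_eq_of_le ?_ (half_le_informationRatio_of_cubeGraph_embedding φ)
  rw [Nat.cast_pow, Nat.cast_ofNat, Real.logb_pow, Real.logb_self_eq_one one_lt_two]
  ring

theorem half_logb_le_largestInformationRatio (d : ℕ) :
    0.5 * Real.logb 2 ((2 ^ d : ℕ) : ℝ) ≤ largestInformationRatio (2 ^ d) := by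
  have e : (Fin d → Bool) ≃ Fin (2 ^ d) := Fintype.equivFinOfCardEq (by simp)
  calc 0.5 * Real.logb 2 ((2 ^ d : ℕ) : ℝ)
      ≤ informationRatio ((cubeGraph d).map e.toEmbedding) :=
        half_logb_le_informationRatio (SimpleGraph.Iso.map e (cubeGraph d)).toEmbedding
    _ ≤ largestInformationRatio (2 ^ d) :=
        le_ciSup (f := informationRatio) (Set.finite_range _).bddAbove _

theorem mainTheorem4 :
    -- the upper bound, for all graphs on `n` vertices
    (∀ n : ℕ, 2 ≤ n → largestInformationRatio n ≤ 4 * (n / Real.logb 2 n)) ∧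
    -- the lower bound, from the cube, which has `n = 2 ^ d` vertices
    (∀ d : ℕ, 2 ≤ d → 0.5 * Real.logb 2 ((2 ^ d : ℕ) : ℝ) ≤ informationRatio (cubeGraph d)) ∧
    -- the corollary
    {n : ℕ | 0.5 * Real.logb 2 n ≤ largestInformationRatio n ∧
      largestInformationRatio n ≤ 4 * (n / Real.logb 2 n)}.Infinite := by
  refine ⟨fun n hn => largestInformationRatio_le hn, fun d _ => half_logb_le_informationRatio .refl,
    ?_⟩
  have hinj : Function.Injective fun d : ℕ => 2 ^ (d + 1) := fun a b h => by simpa using h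
  exact Set.infinite_of_injective_forall_mem hinj fun d =>
    ⟨half_logb_le_largestInformationRatio (d + 1),
      largestInformationRatio_le (le_self_pow₀ one_le_two d.succ_ne_zero)⟩
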